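/- Let $M,N$ be natural numbers and let $\kappa,\hbar,\eta\in\mathbb C$ with $\kappa\ne0$, $\hbar\neq 0$. Operators. Let $e_{ab}$ ($1\le a,b\le M$) be the standard basis of $\mathfrak{gl}_M$. For $x\in U(\mathfrak{gl}_M)$ let $x_{(i)}\in U(\mathfrak{gl}_M)^{\otimes N}$ be $x$ placed in the $i$-th tensor factor, and regard $U(\mathfrak{gl}_M)$ as mapped to $U(\mathfrak{gl}_M)^{\otimes N}$ by the $N$-fold coproduct, so that $e_{ab}=\sum_{i=1}^N (e_{ab})_{(i)}$. Put $\Omega^{+}=\frac12\sum_a e_{aa}\otimes e_{aa}+\sum_{a<b}e_{ab}\otimes e_{ba}$ and $\Omega^{-}=\frac12\sum_a e_{aa}\otimes e_{aa}+\sum_{a<b}e_{ba}\otimes e_{ab}$, and let $\Omega^\pm_{(ij)}$ be $\Omega^{\pm}$ placed in the factors $i,j$ (first leg in the $i$-th one). For $z\in\mathbb C^N$, $\lambda\in\mathbb C^M$ the trigonometric Knizhnik–Zamolodchikov (KZ) and dynamical (DD) operators are $$\nabla^{(t)}_{z_i}(z;\lambda)=\kappa z_i\frac{\partial}{\partial z_i}-\sum_{a=1}^{M}\Big(\lambda_a-\frac{e_{aa}}2\Big)(e_{aa})_{(i)}-\sum_{j\ne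 i}\frac{z_i\Omega^{+}_{(ij)}+z_j\Omega^{-}_{(ij)}}{z_i-z_j},\qquad 1\le i\le N,$$ $$D^{(t)}_{\lambda_a}(z;\lambda)=\kappa\lambda_a\frac{\partial}{\partial\lambda_a}+\frac{e_{aa}^2}{2}-\sum_{i=1}^{N}z_i(e_{aa})_{(i)}-\sum_{b=1}^M\sum_{1\le i<j\le N}(e_{ab})_{(i)}(e_{ba})_{(j)}-\sum_{b\ne a}\frac{\lambda_b(e_{ab}e_{ba}-e_{aa})}{\lambda_a-\lambda_b},\qquad 1\le a\le M.$$ They act on functions with values in an $N$-fold tensor product of $\mathfrak{gl}_M$-modules. The rational-trigonometric operators are obtained by the substitutions $$\nabla^{(rt)}_{z_i}(z;\lambda)=\hbar\,\nabla^{(t)}_{z_i+\eta/\hbar}\big(z+\tfrac{\eta}{\hbar};(1+\tfrac{\eta}{\hbar})\lambda\big),\qquad D^{(rt)}_{\lambda_a}(z;\lambda)=\hbar\,D^{(t)}_{\lambda_a+\eta/\hbar}\big((1+\tfrac{\eta}{\hbar})z;\lambda+\tfrac{\eta}{\hbar}\big),$$ where $\eta/\hbar$ is added to every coordinate. An index $M$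 (resp. $N$) on an operator means that it is built from $\mathfrak{gl}_M$ and $N$ tensor factors (resp. from $\mathfrak{gl}_N$ and $M$ tensor factors, the roles of $z$ and $\lambda$ being exchanged). Duality. Let $\mathfrak{gl}_M$ act on $\mathbb C[x_1,\dots,x_M]$ by $e_{ab}\mapsto x_a\partial/\partial x_b$, and $\mathfrak{gl}_N$ on $\mathbb C[y_1,\dots,y_N]$ likewise, and let $$\Theta:\ \mathbb C[x_1,\dots,x_M]^{\otimes N}\ \xrightarrow{\ \sim\ }\ \mathbb C[y_1,\dots,y_N]^{\otimes M},\qquad \bigotimes_{i=1}^N\prod_{a=1}^M x_a^{d_{ai}}\ \mapsto\ \bigotimes_{a=1}^M\prod_{i=1}^N y_i^{d_{ai}}$$ be the linear isomorphism obtained by identifying both sides with $\mathbb C[x_{ai}:1\le a\le M,\,1\le i\le N]$. Then, under $\Theta$, $$\nabla^{(rt)}_{z_i}(z;\lambda)_{M}\simeq D^{(rt)}_{z_i}(\lambda;z)_{N}\quad(1\le i\le N),\qquad D^{(rt)}_{\lambda_a}(z;\lambda)_{M}\simeq\nabla^{(rt)}_{\lambda_a}(\lambda;z)_{N}\quad(1\le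 a\le M).$$ That is, for every function $u(z;\lambda)$ with values in $\mathbb C[x_1,\dots,x_M]^{\otimes N}$ and every point $(z,\lambda)$: if the coordinates of $z$ are pairwise distinct and $\partial u/\partial z_i$ exists at $(z,\lambda)$, then $\Theta\big(\nabla^{(rt)}_{z_i}(z;\lambda)_M u\big)=D^{(rt)}_{z_i}(\lambda;z)_N(\Theta u)$ at $(z,\lambda)$; if the coordinates of $\lambda$ are pairwise distinct and $\partial u/\partial\lambda_a$ exists at $(z,\lambda)$, then $\Theta\big(D^{(rt)}_{\lambda_a}(z;\lambda)_M u\big)=\nabla^{(rt)}_{\lambda_a}(\lambda;z)_N(\Theta u)$ at $(z,\lambda)$. (Partial derivatives of vector-valued functions are tested on linear functionals.) -/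

import Mathlib

open scoped TensorProduct

noncomputable section

namespace RTDuality

attribute [local instance 100] LieRing.ofAssociativeRing

/-! ### The algebra `U(gl_M)^{⊗N}` -/

/-- The Lie algebra `gl_M` over `ℂ`, with the commutator bracket. -/
abbrev LieGL (M : ℕ) : Type := Matrix (Fin M) (Fin M) ℂ

/-- The universal enveloping algebra `U(gl_M)`. -/
abbrev UGL (M : ℕ) : Type := UniversalEnvelopingAlgebra ℂ (LieGL M)

/-- The algebra `U(gl_M)^{⊗N}`. -/
abbrev UTensor (M N : ℕ) : Type := ⨂[ℂ] _ : Fin N, UGL M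

/-- The generator `e_{ab}` of `U(gl_M)`, the image of the matrix unit. -/
def e {M : ℕ} (a b : Fin M) : UGL M :=
  UniversalEnvelopingAlgebra.ι ℂ (Matrix.single a b (1 : ℂ))

/-- `x ↦ x_{(i)} = 1 ⊗ ⋯ ⊗ x ⊗ ⋯ ⊗ 1`, with `x` at the `i`-th place. -/
def leg {M N : ℕ} (i : Fin N) : UGL M →ₐ[ℂ] UTensor M N :=
  PiTensorProduct.singleAlgHom (R := ℂ) (A := fun _ : Fin N => UGL M) i

theorem commute_leg {M N : ℕ} {i j : Fin N} (hij : i ≠ j) (x y : UGL M) :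
    Commute (leg i x) (leg j y : UTensor M N) := by
  have h := (Pi.mulSingle_commute (f := fun _ : Fin N => UGL M) hij x y).tprod (R := ℂ)
  exact h

/-- `x ↦ x_{(1)} + ⋯ + x_{(N)}` on `gl_M`, as a homomorphism of Lie algebras. -/
def coproductLie (M N : ℕ) : LieGL M →ₗ⁅ℂ⁆ UTensor M N :=
  { (∑ i : Fin N, (leg i : UGL M →ₐ[ℂ] UTensor M N).toLinearMap ∘ₗ
      (UniversalEnvelopingAlgebra.ι ℂ : LieGL M →ₗ⁅ℂ⁆ UGL M).toLinearMap) with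
    map_lie' := by
      intro x y
      simp only [AddHom.toFun_eq_coe, LinearMap.coe_toAddHom, LinearMap.sum_apply,
        LinearMap.comp_apply, LieHom.coe_toLinearMap, AlgHom.toLinearMap_apply, LieHom.map_lie]
      rw [LieRing.of_associative_ring_bracket (A := UTensor M N), Finset.sum_mul_sum, Finset.sum_mul_sum,
        Finset.sum_comm (s := Finset.univ) (t := Finset.univ)
          (f := fun i j : Fin N => leg i (UniversalEnvelopingAlgebra.ι ℂ y) *
            (leg j (UniversalEnvelopingAlgebra.ι ℂ x) : UTensor M N)),
        ← Finset.sum_sub_distrib]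
      refine Finset.sum_congr rfl fun i _ => ?_
      rw [← Finset.sum_sub_distrib, Finset.sum_eq_single i]
      · rw [LieRing.of_associative_ring_bracket, map_sub, map_mul, map_mul]
      · intro j _ hji
        exact sub_eq_zero.2 (commute_leg hji.symm _ _).eq
      · simp }

/-- The `N`-fold coproduct `Δ^N : U(gl_M) → U(gl_M)^{⊗N}`, the algebra homomorphism with
`Δ^N(x) = x_{(1)} + ⋯ + x_{(N)}` for `x ∈ gl_M`. -/
def coproduct (M N : ℕ) : UGL M →ₐ[ℂ] UTensor M N :=
  UniversalEnvelopingAlgebra.lift ℂ (coproductLie M N)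

theorem coproduct_e {M N : ℕ} (a b : Fin M) :
    coproduct M N (e a b) = ∑ i : Fin N, leg i (e a b) := by
  have h : coproduct M N (e a b) = coproductLie M N (Matrix.single a b 1) :=
    UniversalEnvelopingAlgebra.lift_ι_apply ℂ _ _
  rw [h]
  exact LinearMap.sum_apply _ _ _

/-- `Ω⁺_{(ij)}`, where
`Ω⁺ = ½ ∑_a e_{aa} ⊗ e_{aa} + ∑_{a<b} e_{ab} ⊗ e_{ba}`. -/
def omegaPlus {M N : ℕ} (i j : Fin N) : UTensor M N :=
  (1 / 2 : ℂ) • ∑ a : Fin M, leg i (e a a) * leg j (e a a)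
    + ∑ a : Fin M, ∑ b ∈ Finset.univ.filter (fun b => a < b), leg i (e a b) * leg j (e b a)

/-- `Ω⁻_{(ij)}`, where
`Ω⁻ = ½ ∑_a e_{aa} ⊗ e_{aa} + ∑_{a<b} e_{ba} ⊗ e_{ab}`. -/
def omegaMinus {M N : ℕ} (i j : Fin N) : UTensor M N :=
  (1 / 2 : ℂ) • ∑ a : Fin M, leg i (e a a) * leg j (e a a)
    + ∑ a : Fin M, ∑ b ∈ Finset.univ.filter (fun b => a < b), leg i (e b a) * leg j (e a b)

/-- The coefficient
`∑_a (λ_a - e_{aa}/2) (e_{aa})_{(i)} + ∑_{j≠i} (z_i Ω⁺_{(ij)} + z_j Ω⁻_{(ij)}) / (z_i - z_j)`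
of the trigonometric KZ operator. -/
def trigKZCoeff {M N : ℕ} (z : Fin N → ℂ) (lam : Fin M → ℂ) (i : Fin N) : UTensor M N :=
  ∑ a : Fin M, (algebraMap ℂ (UTensor M N) (lam a) - (1 / 2 : ℂ) • coproduct M N (e a a))
      * leg i (e a a)
    + ∑ j ∈ Finset.univ.filter (fun j => j ≠ i),
        (z i - z j)⁻¹ • (z i • omegaPlus i j + z j • omegaMinus i j)

/-- The coefficient
`-e_{aa}²/2 + ∑_i z_i (e_{aa})_{(i)} + ∑_b ∑_{i<j} (e_{ab})_{(i)} (e_{ba})_{(j)}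
  + ∑_{b≠a} λ_b (e_{ab} e_{ba} - e_{aa}) / (λ_a - λ_b)`
of the trigonometric dynamical operator. -/
def trigDDCoeff {M N : ℕ} (z : Fin N → ℂ) (lam : Fin M → ℂ) (a : Fin M) : UTensor M N :=
  -((1 / 2 : ℂ) • coproduct M N (e a a ^ 2))
    + ∑ i : Fin N, z i • leg i (e a a)
    + ∑ b : Fin M, ∑ i : Fin N, ∑ j ∈ Finset.univ.filter (fun j => i < j),
        leg i (e a b) * leg j (e b a)
    + ∑ b ∈ Finset.univ.filter (fun b => b ≠ a),
        (lam b / (lam a - lam b)) • coproduct M N (e a b * e b a - e a a)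

/-! ### Functions with values in a complex vector space, and their partial derivatives -/

section Derivative

variable {ι W W' : Type*} [DecidableEq ι] [AddCommGroup W] [Module ℂ W]
  [AddCommGroup W'] [Module ℂ W']

/-- `w` is the partial derivative `∂f/∂z_i` at `z` of a function `f` with values in a complex
vector space: this is tested on all linear functionals, and is the usual notion when `f` takes
its values in a finite-dimensional subspace. -/
def HasPartialDeriv (f : (ι → ℂ) → W) (i : ι) (w : W) (z : ι → ℂ) : Prop :=
  ∀ l : Module.Dual ℂ W, HasDerivAt (fun t : ℂ => l (f (Function.update z i t))) (l w) (z i)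

/-- `f` has a partial derivative with respect to the `i`-th variable at `z`. -/
def HasPartial (f : (ι → ℂ) → W) (i : ι) (z : ι → ℂ) : Prop :=
  ∃ w, HasPartialDeriv f i w z

open scoped Classical in
/-- The partial derivative `∂f/∂z_i` at `z` (zero if it does not exist). -/
def partialDeriv (f : (ι → ℂ) → W) (i : ι) (z : ι → ℂ) : W :=
  if h : HasPartial f i z then h.choose else 0

theorem HasPartialDeriv.unique {f : (ι → ℂ) → W} {i : ι} {w w' : W} {z : ι → ℂ}
    (h : HasPartialDeriv f i w z) (h' : HasPartialDeriv f i w' z) : w = w' := by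
  rw [← sub_eq_zero, ← Module.forall_dual_apply_eq_zero_iff ℂ]
  intro l
  rw [map_sub, (h l).unique (h' l), sub_self]

theorem HasPartialDeriv.partialDeriv_eq {f : (ι → ℂ) → W} {i : ι} {w : W} {z : ι → ℂ}
    (h : HasPartialDeriv f i w z) : partialDeriv f i z = w := by
  have hex : HasPartial f i z := ⟨w, h⟩
  rw [partialDeriv, dif_pos hex]
  exact hex.choose_spec.unique h

theorem HasPartialDeriv.map {f : (ι → ℂ) → W} {i : ι} {w : W} {z : ι → ℂ}
    (h : HasPartialDeriv f i w z) (L : W →ₗ[ℂ] W') :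
    HasPartialDeriv (fun x => L (f x)) i (L w) z :=
  fun l => h (l ∘ₗ L)

end Derivative

/-! ### The operators -/

section Operators

variable {M N : ℕ} {V : Fin N → Type*} [∀ i, AddCommGroup (V i)] [∀ i, Module ℂ (V i)]

/-- The action of `U(gl_M)^{⊗N}` on the tensor product `V_1 ⊗ ⋯ ⊗ V_N` of `gl_M`-modules, with
`(x_1 ⊗ ⋯ ⊗ x_N) (v_1 ⊗ ⋯ ⊗ v_N) = x_1 v_1 ⊗ ⋯ ⊗ x_N v_N`. -/
def act (ρ : ∀ i, LieGL M →ₗ⁅ℂ⁆ Module.End ℂ (V i)) :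
    UTensor M N →ₐ[ℂ] Module.End ℂ (⨂[ℂ] i, V i) :=
  PiTensorProduct.liftAlgHom
    ((PiTensorProduct.mapMultilinear ℂ V V).compLinearMap
      fun i => (UniversalEnvelopingAlgebra.lift ℂ (ρ i)).toLinearMap)
    (by simp [PiTensorProduct.map_id, Module.End.one_eq_id])
    (by
      intro x y
      simp only [MultilinearMap.compLinearMap_apply, Pi.mul_apply, AlgHom.toLinearMap_apply,
        map_mul, PiTensorProduct.mapMultilinear_apply, PiTensorProduct.map_mul])

theorem act_tprod (ρ : ∀ i, LieGL M →ₗ⁅ℂ⁆ Module.End ℂ (V i)) (x : Fin N → UGL M) (v : ∀ i, V i) :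
    act ρ (PiTensorProduct.tprod ℂ x) (PiTensorProduct.tprod ℂ v) =
      PiTensorProduct.tprod ℂ fun i => UniversalEnvelopingAlgebra.lift ℂ (ρ i) (x i) (v i) := by
  simp [act, PiTensorProduct.map_tprod]

/-- The trigonometric KZ operator
`∇^{(t)}_{z_i}(z; λ) = κ z_i ∂/∂z_i - ∑_a (λ_a - e_{aa}/2) (e_{aa})_{(i)}
  - ∑_{j≠i} (z_i Ω⁺_{(ij)} + z_j Ω⁻_{(ij)}) / (z_i - z_j)`,
acting, for fixed `λ`, on functions of `z`. -/
def trigKZ (ρ : ∀ i, LieGL M →ₗ⁅ℂ⁆ Module.End ℂ (V i)) (κ : ℂ) (lam : Fin M → ℂ) (i : Fin N)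
    (f : (Fin N → ℂ) → ⨂[ℂ] j, V j) (z : Fin N → ℂ) : ⨂[ℂ] j, V j :=
  (κ * z i) • partialDeriv f i z - act ρ (trigKZCoeff z lam i) (f z)

/-- The rational-trigonometric KZ operator
`∇^{(rt)}_{z_i}(z; λ) = ħ ∇^{(t)}_{z_i + η/ħ}(z + η/ħ; (1 + η/ħ) λ)`: the trigonometric operator in
the variables `w_i = z_i + η/ħ`, with parameters `(1 + η/ħ) λ`. -/
def rtKZ (ρ : ∀ i, LieGL M →ₗ⁅ℂ⁆ Module.End ℂ (V i)) (κ hbar η : ℂ) (lam : Fin M → ℂ) (i : Fin N)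
    (f : (Fin N → ℂ) → ⨂[ℂ] j, V j) (z : Fin N → ℂ) : ⨂[ℂ] j, V j :=
  hbar • trigKZ ρ κ (fun a => (1 + η / hbar) * lam a) i
    (fun w => f fun j => w j - η / hbar) (fun j => z j + η / hbar)

/-- The trigonometric dynamical operator
`D^{(t)}_{λ_a}(z; λ) = κ λ_a ∂/∂λ_a + e_{aa}²/2 - ∑_i z_i (e_{aa})_{(i)}
  - ∑_b ∑_{i<j} (e_{ab})_{(i)} (e_{ba})_{(j)} - ∑_{b≠a} λ_b (e_{ab} e_{ba} - e_{aa}) / (λ_a - λ_b)`,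
acting, for fixed `z`, on functions of `λ`. -/
def trigDD (ρ : ∀ i, LieGL M →ₗ⁅ℂ⁆ Module.End ℂ (V i)) (κ : ℂ) (z : Fin N → ℂ) (a : Fin M)
    (f : (Fin M → ℂ) → ⨂[ℂ] j, V j) (lam : Fin M → ℂ) : ⨂[ℂ] j, V j :=
  (κ * lam a) • partialDeriv f a lam - act ρ (trigDDCoeff z lam a) (f lam)

/-- The rational-trigonometric dynamical operator
`D^{(rt)}_{λ_a}(z; λ) = ħ D^{(t)}_{λ_a + η/ħ}((1 + η/ħ) z; λ + η/ħ)`: the trigonometric operator in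
the variables `μ_a = λ_a + η/ħ`, with parameters `(1 + η/ħ) z`. -/
def rtDD (ρ : ∀ i, LieGL M →ₗ⁅ℂ⁆ Module.End ℂ (V i)) (κ hbar η : ℂ) (z : Fin N → ℂ) (a : Fin M)
    (f : (Fin M → ℂ) → ⨂[ℂ] j, V j) (lam : Fin M → ℂ) : ⨂[ℂ] j, V j :=
  hbar • trigDD ρ κ (fun i => (1 + η / hbar) * z i) a
    (fun μ => f fun b => μ b - η / hbar) (fun b => lam b + η / hbar)

end Operators

/-! ### The `(gl_M, gl_N)` duality -/

/-- The derivation `∑_{a,b} A_{ab} x_a ∂/∂x_b` of `ℂ[x_1, …, x_M]`, with `x_b ↦ ∑_a A_{ab} x_a`. -/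
def linDer {M : ℕ} (A : LieGL M) :
    Derivation ℂ (MvPolynomial (Fin M) ℂ) (MvPolynomial (Fin M) ℂ) :=
  MvPolynomial.mkDerivation ℂ fun b => ∑ a, A a b • MvPolynomial.X a

theorem linDer_X {M : ℕ} (A : LieGL M) (b : Fin M) :
    linDer A (MvPolynomial.X b) = ∑ a, A a b • MvPolynomial.X a :=
  MvPolynomial.mkDerivation_X _ _ _

theorem linDer_add {M : ℕ} (A B : LieGL M) : linDer (A + B) = linDer A + linDer B := by
  apply MvPolynomial.derivation_ext
  intro b
  simp [linDer_X, add_smul, Finset.sum_add_distrib]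

theorem linDer_smul {M : ℕ} (c : ℂ) (A : LieGL M) : linDer (c • A) = c • linDer A := by
  apply MvPolynomial.derivation_ext
  intro b
  simp [linDer_X, mul_smul, Finset.smul_sum]

theorem linDer_lie {M : ℕ} (A B : LieGL M) : linDer ⁅A, B⁆ = ⁅linDer A, linDer B⁆ := by
  apply MvPolynomial.derivation_ext
  intro b
  simp only [Derivation.commutator_apply, linDer_X, map_sum, Derivation.map_smul,
    LieRing.of_associative_ring_bracket, Matrix.sub_apply, Matrix.mul_apply, sub_smul,
    Finset.sum_sub_distrib, Finset.sum_smul, Finset.smul_sum, smul_smul]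
  congr 1
  · rw [Finset.sum_comm]
    simp only [mul_comm]
  · rw [Finset.sum_comm]
    simp only [mul_comm]

/-- The `gl_M`-module `ℂ[x_1, …, x_M]`, where `e_{ab}` acts as `x_a ∂/∂x_b`. -/
def polyRep (M : ℕ) : LieGL M →ₗ⁅ℂ⁆ Module.End ℂ (MvPolynomial (Fin M) ℂ) where
  toFun A := (linDer A).toLinearMap
  map_add' A B := by rw [linDer_add]; rfl
  map_smul' c A := by rw [linDer_smul]; rfl
  map_lie' := by
    intro A B
    rw [linDer_lie]
    refine LinearMap.ext fun p => ?_
    exact Derivation.commutator_apply (D1 := linDer A) (D2 := linDer B) (a := p)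

theorem polyRep_single {M : ℕ} (a b : Fin M) (p : MvPolynomial (Fin M) ℂ) :
    polyRep M (Matrix.single a b 1) p = MvPolynomial.X a * MvPolynomial.pderiv b p := by
  have h : linDer (Matrix.single a b 1) =
      (MvPolynomial.X a : MvPolynomial (Fin M) ℂ) • MvPolynomial.pderiv (R := ℂ) b := by
    apply MvPolynomial.derivation_ext
    intro c
    rw [linDer_X, Finset.sum_eq_single a]
    · by_cases hbc : b = c
      · subst hbc
        simp
      · simp [hbc, MvPolynomial.pderiv_X_of_ne (Ne.symm hbc)]
    · intro d _ hd
      simp [hd.symm]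
    · simp
  exact congrArg (fun D : Derivation ℂ (MvPolynomial (Fin M) ℂ) (MvPolynomial (Fin M) ℂ) => D p) h

/-- The `gl_M`-module `ℂ[x_1, …, x_M]^{⊗N}`. -/
abbrev PolyTensor (M N : ℕ) : Type := ⨂[ℂ] _ : Fin N, MvPolynomial (Fin M) ℂ

/-- Transposition of an array of exponents `(d_{ai})`. -/
def transposeExp (M N : ℕ) : (Fin N → Fin M →₀ ℕ) ≃ (Fin M → Fin N →₀ ℕ) :=
  ((Equiv.piCongrRight fun _ => Finsupp.equivFunOnFinite).trans
    (Equiv.piComm fun (_ : Fin N) (_ : Fin M) => ℕ)).trans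
    (Equiv.piCongrRight fun _ => Finsupp.equivFunOnFinite.symm)

/-- The basis of `ℂ[x_1, …, x_M]^{⊗N}` made of the tensor products of monomials. -/
def monomialBasis (M N : ℕ) : Module.Basis (Fin N → Fin M →₀ ℕ) ℂ (PolyTensor M N) :=
  Basis.piTensorProduct fun _ => MvPolynomial.basisMonomials (Fin M) ℂ

/-- The isomorphism
`ℂ[x_1, …, x_M]^{⊗N} ≅ ℂ[x_{ai} : 1 ≤ a ≤ M, 1 ≤ i ≤ N] ≅ ℂ[y_1, …, y_N]^{⊗M}`
of the `(gl_M, gl_N)` duality: on both sides a tensor product of monomials is identified with the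
monomial `∏_{a,i} x_{ai}^{d_{ai}}`, so that
`⨂_i ∏_a x_a^{d_{ai}} ↦ ⨂_a ∏_i y_i^{d_{ai}}`. -/
def dualityIso (M N : ℕ) : PolyTensor M N ≃ₗ[ℂ] PolyTensor N M :=
  (monomialBasis M N).equiv (monomialBasis N M) (transposeExp M N)

theorem transposeExp_apply {M N : ℕ} (d : Fin N → Fin M →₀ ℕ) (a : Fin M) (i : Fin N) :
    transposeExp M N d a i = d i a := rfl

theorem dualityIso_tprod_monomial {M N : ℕ} (d : Fin N → Fin M →₀ ℕ) :
    dualityIso M N (PiTensorProduct.tprod ℂ fun i => MvPolynomial.monomial (d i) 1) =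
      PiTensorProduct.tprod ℂ fun a => MvPolynomial.monomial (transposeExp M N d a) 1 := by
  have h := (monomialBasis M N).equiv_apply (b' := monomialBasis N M) d (transposeExp M N)
  simpa [monomialBasis, dualityIso] using h

end RTDuality

end

/-!
The space `ℂ[x_1, …, x_M]^{⊗N}` is the polynomial ring in the variables `x_{ai}`, and it carries
the operators `x_{ai}` (`coord`) and `∂/∂x_{ai}` (`partialX`), which satisfy the relations of the
Weyl algebra (`isWeyl_coord_partialX`). The matrix unit `e_{ab}` of `gl_M` in the `i`-th factor acts
as `x_{ai} ∂/∂x_{bi}` (`act_leg_e`), and the matrix unit `e_{ij}` of `gl_N` in the `a`-th factor of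
`ℂ[y_1, …, y_N]^{⊗M}` as `x_{ai} ∂/∂x_{aj}`, once the duality isomorphism is used to exchange the
two indices (`dualityIso_conj_coord`, `dualityIso_conj_partialX`).

Write `n_{ai} = x_{ai} ∂/∂x_{ai}` and `E_{ij} = ∑_a x_{ai} ∂/∂x_{aj}`. The duality is then an
identity between two elements of the Weyl algebra, `IsWeyl.kz_eq_dd`. It follows from
`(z_i Ω⁺ + z_j Ω⁻) / (z_i - z_j) = Ω⁺ + z_j / (z_i - z_j) (Ω⁺ + Ω⁻)` and two facts:
* `Ω⁺_{(ij)} + Ω⁻_{(ij)} = E_{ij} E_{ji} - E_{ii}` for `i ≠ j`, where `E_{ii}` is the commutator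
  term of normal ordering (`IsWeyl.quadratic_eq_casimir`);
* what remains does not depend on `z` and `λ` apart from the common term `∑_a λ_a n_{ai}`, and both
  remainders reduce to `-½ ∑_a n_{ai}² + ∑_{j≠i} ∑_{a<b} x_{ai} ∂_{bi} x_{bj} ∂_{aj}`
  (`IsWeyl.constant_part`).

The shift by `η/ħ` and the rescaling are the same on the two sides, so the rational-trigonometric
operators need nothing more. The second half of the duality is the first one with `M` and `N`
exchanged, because the inverse of the duality isomorphism is again a duality isomorphism.
-/

namespace RTDuality

attribute [local instance 100] LieRing.ofAssociativeRing

/-! ### Identities in the Weyl algebra -/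

section Weyl

variable {A : Type*} [Ring A] {M N : ℕ}

/-- The relations of the Weyl algebra in the generators `x_{ai}` (coordinates) and `d_{ai}`
(partial derivatives). -/
structure IsWeyl (x d : Fin M → Fin N → A) : Prop where
  xx : ∀ a i b j, Commute (x a i) (x b j)
  dd : ∀ a i b j, Commute (d a i) (d b j)
  dx_of_ne : ∀ a i b j, (a, i) ≠ (b, j) → Commute (d a i) (x b j)
  dx : ∀ a i, d a i * x a i = x a i * d a i + 1

theorem sum_mul_sum_eq_diag_add_lt {ι : Type*} [Fintype ι] [LinearOrder ι] (f : ι → ι → A) :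
    ∑ a, ∑ b, f a b = ∑ a, f a a + (∑ a, ∑ b ∈ Finset.univ.filter (fun b => a < b), f a b
      + ∑ a, ∑ b ∈ Finset.univ.filter (fun b => a < b), f b a) := by
  have h : ∀ a b, f a b = (if a = b then f a b else 0)
      + ((if a < b then f a b else 0) + if b < a then f a b else 0) := by
    intro a b
    rcases lt_trichotomy a b with h | h | h
    · simp [h, h.ne, h.le]
    · simp [h]
    · simp [h, h.ne', h.le]
  rw [Finset.sum_congr rfl fun a _ => Finset.sum_congr rfl fun b _ => h a b]
  simp only [Finset.sum_add_distrib, Finset.sum_filter, Finset.sum_ite_eq, Finset.mem_univ, if_true]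
  congr 2
  exact Finset.sum_comm

namespace IsWeyl

variable {x d : Fin M → Fin N → A}

theorem mul_comm_of_ne (h : IsWeyl x d) {i j : Fin N} (hij : i ≠ j) {a b : Fin M} (hab : a ≠ b) :
    x a i * d a j * (x b j * d b i) = x a i * d b i * (x b j * d a j) := by
  have h1 := (h.dx_of_ne a j b j (by simp [hab])).eq
  have h2 := (h.dx_of_ne b i b j (by simp [hij])).eq
  have h3 := (h.dd a j b i).eq
  calc x a i * d a j * (x b j * d b i) = x a i * (d a j * x b j) * d b i := by noncomm_ring
    _ = x a i * x b j * (d a j * d b i) := by rw [h1]; noncomm_ring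
    _ = x a i * (x b j * d b i) * d a j := by rw [h3]; noncomm_ring
    _ = _ := by rw [← h2]; noncomm_ring

/-- Reordering `∂_{aj} x_{aj}` produces the extra term `x_{ai} ∂_{ai}`. -/
theorem mul_self_index (h : IsWeyl x d) {i j : Fin N} (hij : i ≠ j) (a : Fin M) :
    x a i * d a j * (x a j * d a i) = x a i * d a i * (x a j * d a j) + x a i * d a i := by
  have h1 := h.dx a j
  have h2 := (h.dx_of_ne a i a j (by simp [hij])).eq
  have h3 := (h.dd a j a i).eq
  calc x a i * d a j * (x a j * d a i) = x a i * (d a j * x a j) * d a i := by noncomm_ring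
    _ = x a i * x a j * (d a j * d a i) + x a i * d a i := by rw [h1]; noncomm_ring
    _ = x a i * (x a j * d a i) * d a j + x a i * d a i := by rw [h3]; noncomm_ring
    _ = _ := by rw [← h2]; noncomm_ring

theorem number_comm (h : IsWeyl x d) {i j : Fin N} {a b : Fin M} (hne : (a, i) ≠ (b, j)) :
    x a i * d a i * (x b j * d b j) = x b j * d b j * (x a i * d a i) := by
  have h1 : Commute (x a i * d a i) (x b j) := (h.xx a i b j).mul_left (h.dx_of_ne a i b j hne)
  have h2 : Commute (x a i * d a i) (d b j) :=
    (h.dx_of_ne b j a i hne.symm).symm.mul_left (h.dd a i b j)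
  exact (h1.mul_right h2).eq

/-- The quadratic expression `E_{ij} E_{ji} - E_{ii}` of `gl_N` is the polarized Casimir
`Ω⁺_{(ij)} + Ω⁻_{(ij)}` of `gl_M`. -/
theorem quadratic_eq_casimir [Algebra ℂ A] (h : IsWeyl x d) {i j : Fin N} (hij : i ≠ j) :
    (∑ a, x a i * d a j) * (∑ a, x a j * d a i) - ∑ a, x a i * d a i =
      ((1 / 2 : ℂ) • ∑ a, x a i * d a i * (x a j * d a j)
        + ∑ a, ∑ b ∈ Finset.univ.filter (fun b => a < b), x a i * d b i * (x b j * d a j))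
      + ((1 / 2 : ℂ) • ∑ a, x a i * d a i * (x a j * d a j)
        + ∑ a, ∑ b ∈ Finset.univ.filter (fun b => a < b), x b i * d a i * (x a j * d b j)) := by
  rw [Finset.sum_mul_sum, sum_mul_sum_eq_diag_add_lt]
  have e1 : ∑ a, ∑ b ∈ Finset.univ.filter (fun b => a < b), x a i * d a j * (x b j * d b i)
      = ∑ a, ∑ b ∈ Finset.univ.filter (fun b => a < b), x a i * d b i * (x b j * d a j) :=
    Finset.sum_congr rfl fun a _ => Finset.sum_congr rfl fun b hb =>
      h.mul_comm_of_ne hij (Finset.mem_filter.1 hb).2.ne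
  have e2 : ∑ a, ∑ b ∈ Finset.univ.filter (fun b => a < b), x b i * d b j * (x a j * d a i)
      = ∑ a, ∑ b ∈ Finset.univ.filter (fun b => a < b), x b i * d a i * (x a j * d b j) :=
    Finset.sum_congr rfl fun a _ => Finset.sum_congr rfl fun b hb =>
      h.mul_comm_of_ne hij (Finset.mem_filter.1 hb).2.ne'
  rw [e1, e2, Finset.sum_congr rfl fun a _ => h.mul_self_index hij a, Finset.sum_add_distrib]
  module

/-- The parts of the two coefficients that do not depend on `z` and `λ` agree. The terms
`n_{ak} n_{ai}` with `k ≠ i` cancel on the left, where `n_{ai} = x_{ai} ∂_{ai}`, and the terms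
`n_{ai} n_{bi}` with `a ≠ b` cancel on the right. -/
theorem constant_part [Algebra ℂ A] (h : IsWeyl x d) (i : Fin N) :
    -(∑ a, ((1 / 2 : ℂ) • ∑ k, x a k * d a k) * (x a i * d a i))
      + ∑ j ∈ Finset.univ.filter (fun j => j ≠ i),
        ((1 / 2 : ℂ) • ∑ a, x a i * d a i * (x a j * d a j)
        + ∑ a, ∑ b ∈ Finset.univ.filter (fun b => a < b), x a i * d b i * (x b j * d a j)) =
    -((1 / 2 : ℂ) • (∑ a, x a i * d a i) ^ 2)
      + ∑ j, ∑ a, ∑ b ∈ Finset.univ.filter (fun b => a < b), x a i * d a j * (x b j * d b i) := by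
  have split : ∀ f : Fin N → A,
      ∑ j, f j = f i + ∑ j ∈ Finset.univ.filter (fun j => j ≠ i), f j := by
    intro f
    rw [Finset.filter_ne', Finset.add_sum_erase _ _ (Finset.mem_univ i)]
  have e1 : ∑ a, ((1 / 2 : ℂ) • ∑ k, x a k * d a k) * (x a i * d a i) =
      (1 / 2 : ℂ) • ∑ a, x a i * d a i * (x a i * d a i) +
      ∑ j ∈ Finset.univ.filter (fun j => j ≠ i),
        (1 / 2 : ℂ) • ∑ a, x a i * d a i * (x a j * d a j) := by
    rw [← Finset.smul_sum, ← smul_add, Finset.sum_comm, ← Finset.sum_add_distrib, Finset.smul_sum]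
    refine Finset.sum_congr rfl fun a _ => ?_
    rw [split, smul_mul_assoc, add_mul, Finset.sum_mul]
    congr 2
    exact Finset.sum_congr rfl fun j hj =>
      h.number_comm (by simpa using (Finset.mem_filter.1 hj).2)
  have e2 : (∑ a, x a i * d a i) ^ 2 = ∑ a, x a i * d a i * (x a i * d a i)
      + (2 : ℂ) • ∑ a, ∑ b ∈ Finset.univ.filter (fun b => a < b),
          x a i * d a i * (x b i * d b i) := by
    rw [sq, Finset.sum_mul_sum, sum_mul_sum_eq_diag_add_lt, two_smul]
    congr 2
    exact Finset.sum_congr rfl fun a _ => Finset.sum_congr rfl fun b hb =>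
      h.number_comm (by simpa using fun hba => ((Finset.mem_filter.1 hb).2.ne' hba).elim)
  have e3 : ∑ j ∈ Finset.univ.filter (fun j => j ≠ i),
        ∑ a, ∑ b ∈ Finset.univ.filter (fun b => a < b), x a i * d a j * (x b j * d b i)
      = ∑ j ∈ Finset.univ.filter (fun j => j ≠ i),
        ∑ a, ∑ b ∈ Finset.univ.filter (fun b => a < b), x a i * d b i * (x b j * d a j) :=
    Finset.sum_congr rfl fun j hj => Finset.sum_congr rfl fun a _ =>
      Finset.sum_congr rfl fun b hb =>
      h.mul_comm_of_ne (Finset.mem_filter.1 hj).2.symm (Finset.mem_filter.1 hb).2.ne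
  rw [split (fun j => ∑ a, _), e1, e2, e3, Finset.sum_add_distrib]
  module

/-- The coefficient of the KZ operator of `gl_M` equals that of the dynamical operator of `gl_N`,
as elements of the Weyl algebra. -/
theorem kz_eq_dd [Algebra ℂ A] (h : IsWeyl x d) {z : Fin N → ℂ} (hz : Function.Injective z)
    (lam : Fin M → ℂ) (i : Fin N) :
    ∑ a, (algebraMap ℂ A (lam a) - (1 / 2 : ℂ) • ∑ k, x a k * d a k) * (x a i * d a i)
      + ∑ j ∈ Finset.univ.filter (fun j => j ≠ i), (z i - z j)⁻¹ •
        (z i • ((1 / 2 : ℂ) • ∑ a, x a i * d a i * (x a j * d a j)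
          + ∑ a, ∑ b ∈ Finset.univ.filter (fun b => a < b), x a i * d b i * (x b j * d a j))
        + z j • ((1 / 2 : ℂ) • ∑ a, x a i * d a i * (x a j * d a j)
          + ∑ a, ∑ b ∈ Finset.univ.filter (fun b => a < b), x b i * d a i * (x a j * d b j))) =
    -((1 / 2 : ℂ) • (∑ a, x a i * d a i) ^ 2)
      + ∑ a, lam a • (x a i * d a i)
      + ∑ j, ∑ a, ∑ b ∈ Finset.univ.filter (fun b => a < b), x a i * d a j * (x b j * d b i)
      + ∑ j ∈ Finset.univ.filter (fun j => j ≠ i), (z j / (z i - z j)) •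
        ((∑ a, x a i * d a j) * (∑ a, x a j * d a i) - ∑ a, x a i * d a i) := by
  -- `(c P + c' Q) / (c - c')` is `P` plus a multiple of `P + Q`.
  have key : ∀ (c c' : ℂ) (P Q : A), c - c' ≠ 0 →
      (c - c')⁻¹ • (c • P + c' • Q) = P + (c' / (c - c')) • (P + Q) := by
    intro c c' P Q hc
    have h1 : (c - c')⁻¹ * c = 1 + c' / (c - c') := by field_simp; ring
    rw [smul_add, smul_smul, smul_smul, h1, div_eq_mul_inv, mul_comm c']
    module
  have e1 := h.constant_part i
  rw [Finset.sum_congr rfl fun j hj => key (z i) (z j) _ _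
    (sub_ne_zero.2 (hz.ne (Finset.mem_filter.1 hj).2.symm)), Finset.sum_add_distrib,
    Finset.sum_congr rfl fun j hj => congrArg (fun T => (z j / (z i - z j)) • T)
      (h.quadratic_eq_casimir (Finset.mem_filter.1 hj).2.symm)]
  simp only [sub_mul, Finset.sum_sub_distrib, ← Algebra.smul_def]
  rw [← add_assoc]
  congr 1
  rw [add_right_comm, ← e1]
  abel

end IsWeyl

end Weyl

/-! ### Coordinates and derivatives on the tensor product -/

section EndLeg

variable {ι V : Type*} [DecidableEq ι] [AddCommGroup V] [Module ℂ V]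

/-- The endomorphism `f` placed at the `i`-th factor of `V^{⊗ι}`, linearly in `f`. -/
noncomputable def endLegLin (i : ι) : Module.End ℂ V →ₗ[ℂ] Module.End ℂ (⨂[ℂ] _ : ι, V) :=
  (PiTensorProduct.mapMultilinear ℂ (fun _ : ι => V) (fun _ : ι => V)).toLinearMap
    (fun _ => LinearMap.id) i

theorem endLegLin_tprod (i : ι) (f : Module.End ℂ V) (v : ι → V) :
    endLegLin i f (PiTensorProduct.tprod ℂ v) =
      PiTensorProduct.tprod ℂ (Function.update v i (f (v i))) := by
  rw [endLegLin, MultilinearMap.toLinearMap_apply, PiTensorProduct.mapMultilinear_apply,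
    PiTensorProduct.map_tprod]
  congr 1
  ext1 j
  by_cases h : j = i
  · subst h; simp
  · simp [h]

/-- The endomorphism `f` placed at the `i`-th factor of `V^{⊗ι}`. -/
noncomputable def endLeg (i : ι) : Module.End ℂ V →ₐ[ℂ] Module.End ℂ (⨂[ℂ] _ : ι, V) :=
  AlgHom.ofLinearMap (endLegLin i)
    (PiTensorProduct.ext <| MultilinearMap.ext fun v => by
      rw [LinearMap.compMultilinearMap_apply, LinearMap.compMultilinearMap_apply, endLegLin_tprod]
      simp)
    (fun f g => PiTensorProduct.ext <| MultilinearMap.ext fun v => by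
      rw [LinearMap.compMultilinearMap_apply, LinearMap.compMultilinearMap_apply,
        Module.End.mul_apply, endLegLin_tprod, endLegLin_tprod, endLegLin_tprod]
      simp)

theorem endLeg_tprod (i : ι) (f : Module.End ℂ V) (v : ι → V) :
    endLeg i f (PiTensorProduct.tprod ℂ v) =
      PiTensorProduct.tprod ℂ (Function.update v i (f (v i))) :=
  endLegLin_tprod i f v

theorem commute_endLeg {i j : ι} (hij : i ≠ j) (f g : Module.End ℂ V) :
    Commute (endLeg i f) (endLeg j g) :=
  PiTensorProduct.ext <| MultilinearMap.ext fun v => by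
    rw [LinearMap.compMultilinearMap_apply, LinearMap.compMultilinearMap_apply,
      Module.End.mul_apply, Module.End.mul_apply, endLeg_tprod, endLeg_tprod, endLeg_tprod,
      endLeg_tprod, Function.update_of_ne hij, Function.update_of_ne hij.symm,
      Function.update_comm hij]

end EndLeg

/-- Multiplication by `x_{ai}`, that is, by `x_a` in the `i`-th factor. -/
noncomputable def coord {M N : ℕ} (a : Fin M) (i : Fin N) : Module.End ℂ (PolyTensor M N) :=
  endLeg i (LinearMap.mulLeft ℂ (MvPolynomial.X a))

/-- The derivative `∂/∂x_{ai}`, that is, `∂/∂x_a` in the `i`-th factor. -/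
noncomputable def partialX {M N : ℕ} (a : Fin M) (i : Fin N) : Module.End ℂ (PolyTensor M N) :=
  endLeg i (MvPolynomial.pderiv a).toLinearMap

theorem pderiv_pderiv_comm {M : ℕ} (a b : Fin M) (p : MvPolynomial (Fin M) ℂ) :
    MvPolynomial.pderiv a (MvPolynomial.pderiv b p) =
      MvPolynomial.pderiv b (MvPolynomial.pderiv a p) := by
  have h : ⁅MvPolynomial.pderiv (R := ℂ) a, MvPolynomial.pderiv (R := ℂ) b⁆ = 0 := by
    refine MvPolynomial.derivation_ext fun c => ?_
    rw [Derivation.commutator_apply]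
    simp [MvPolynomial.pderiv_X, Pi.single_apply, apply_ite]
  rw [← sub_eq_zero, ← Derivation.commutator_apply, h, Derivation.zero_apply]

theorem isWeyl_coord_partialX (M N : ℕ) :
    IsWeyl (coord : Fin M → Fin N → Module.End ℂ (PolyTensor M N)) partialX where
  xx a i b j := by
    by_cases hij : i = j
    · subst hij
      refine Commute.map (LinearMap.ext fun p => ?_) (endLeg i)
      simp [mul_left_comm]
    · exact commute_endLeg hij _ _
  dd a i b j := by
    by_cases hij : i = j
    · subst hij
      refine Commute.map (LinearMap.ext fun p => ?_) (endLeg i)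
      exact pderiv_pderiv_comm a b p
    · exact commute_endLeg hij _ _
  dx_of_ne a i b j hne := by
    by_cases hij : i = j
    · subst hij
      have hab : b ≠ a := fun h => hne (by rw [h])
      refine Commute.map (LinearMap.ext fun p => ?_) (endLeg i)
      simp [MvPolynomial.pderiv_X_of_ne hab]
    · exact commute_endLeg hij _ _
  dx a i := by
    rw [coord, partialX, ← map_mul, ← map_mul, ← map_one (endLeg i), ← map_add]
    congr 1
    refine LinearMap.ext fun p => ?_
    simp

theorem act_leg_e {M N : ℕ} (i : Fin N) (a b : Fin M) :
    act (fun _ => polyRep M) (leg i (e a b) : UTensor M N) = coord a i * partialX b i := by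
  rw [coord, partialX, ← map_mul]
  refine PiTensorProduct.ext (MultilinearMap.ext fun v => ?_)
  rw [LinearMap.compMultilinearMap_apply, LinearMap.compMultilinearMap_apply, endLeg_tprod]
  have : (leg i (e a b) : UTensor M N) = PiTensorProduct.tprod ℂ (Pi.mulSingle i (e a b)) := rfl
  rw [this, act_tprod]
  congr 1
  ext1 j
  by_cases h : j = i
  · subst h
    simp [e, polyRep_single]
  · simp [h]

/-! ### The duality isomorphism exchanges the two indices -/

theorem dualityIso_symm (M N : ℕ) : (dualityIso M N).symm = dualityIso N M := by
  rw [dualityIso, Module.Basis.equiv_symm]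
  rfl

theorem dualityIso_tprod_monomial_transposeExp {M N : ℕ} (v : Fin N → Fin M →₀ ℕ) :
    dualityIso N M (PiTensorProduct.tprod ℂ fun a =>
      MvPolynomial.monomial (transposeExp M N v a) 1) =
      PiTensorProduct.tprod ℂ fun i => MvPolynomial.monomial (v i) 1 :=
  (dualityIso_tprod_monomial (transposeExp M N v)).trans (by
    have h : transposeExp N M (transposeExp M N v) = v := by
      ext i a
      rfl
    rw [h])

theorem monomialBasis_apply {M N : ℕ} (v : Fin N → Fin M →₀ ℕ) :
    monomialBasis M N v = PiTensorProduct.tprod ℂ fun i => MvPolynomial.monomial (v i) 1 := by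
  simp [monomialBasis]

theorem coord_tprod_monomial {M N : ℕ} (a : Fin M) (i : Fin N) (v : Fin N → Fin M →₀ ℕ) :
    coord a i (PiTensorProduct.tprod ℂ fun i => MvPolynomial.monomial (v i) (1 : ℂ)) =
      PiTensorProduct.tprod ℂ fun k => MvPolynomial.monomial
        (Function.update v i (v i + Finsupp.single a 1) k) 1 := by
  rw [coord, endLeg_tprod]
  congr 1
  ext1 k
  by_cases h : k = i
  · subst h
    simp [MvPolynomial.X, MvPolynomial.monomial_mul, add_comm]
  · simp [h]

theorem partialX_tprod_monomial {M N : ℕ} (a : Fin M) (i : Fin N) (v : Fin N → Fin M →₀ ℕ) :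
    partialX a i (PiTensorProduct.tprod ℂ fun i => MvPolynomial.monomial (v i) (1 : ℂ)) =
      (v i a : ℂ) • PiTensorProduct.tprod ℂ fun k => MvPolynomial.monomial
        (Function.update v i (v i - Finsupp.single a 1) k) 1 := by
  rw [partialX, endLeg_tprod]
  have h1 : (MvPolynomial.pderiv a).toLinearMap (MvPolynomial.monomial (v i) (1 : ℂ)) =
      (v i a : ℂ) • MvPolynomial.monomial (v i - Finsupp.single a 1) 1 := by
    simp [MvPolynomial.pderiv_monomial, MvPolynomial.smul_monomial]
  rw [h1, MultilinearMap.map_update_smul]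
  congr 2
  ext1 k
  by_cases h : k = i
  · subst h; simp
  · simp [h]

/-- Changing the entry `(a, i)` of an array of exponents commutes with transposition. The change is
given by `f`, which is addition or truncated subtraction of a unit array. -/
theorem transposeExp_update {M N : ℕ} (f : ℕ → ℕ → ℕ) (hf : ∀ m, f m 0 = m)
    (v : Fin N → Fin M →₀ ℕ) (a : Fin M) (i : Fin N)
    (s : Fin M →₀ ℕ) (hs : ∀ b, s b = f (v i b) (Finsupp.single a 1 b))
    (t : Fin N →₀ ℕ) (ht : ∀ j, t j = f (v j a) (Finsupp.single i 1 j)) :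
    transposeExp M N (Function.update v i s) = Function.update (transposeExp M N v) a t := by
  ext b j
  rw [transposeExp_apply]
  by_cases hj : j = i <;> by_cases hb : b = a
  · subst hj hb; simp [hs, ht]
  · subst hj; simp [hs, hb, hf, transposeExp_apply]
  · subst hb; simp [ht, hj, hf]
  · simp [hj, hb, transposeExp_apply]

theorem dualityIso_conj_coord {M N : ℕ} (a : Fin M) (i : Fin N) :
    (dualityIso M N).conjAlgEquiv ℂ (coord a i) = coord i a := by
  rw [LinearEquiv.conjAlgEquiv_apply, dualityIso_symm]
  refine (monomialBasis N M).ext fun w => ?_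
  obtain ⟨v, rfl⟩ := (transposeExp M N).surjective w
  rw [monomialBasis_apply, LinearMap.comp_apply, LinearMap.comp_apply, LinearEquiv.coe_coe,
    LinearEquiv.coe_coe, dualityIso_tprod_monomial_transposeExp, coord_tprod_monomial,
    coord_tprod_monomial, dualityIso_tprod_monomial,
    transposeExp_update (· + ·) (fun _ => rfl) v a i _ (fun _ => rfl)
      (transposeExp M N v a + Finsupp.single i 1) (fun _ => rfl)]

theorem dualityIso_conj_partialX {M N : ℕ} (a : Fin M) (i : Fin N) :
    (dualityIso M N).conjAlgEquiv ℂ (partialX a i) = partialX i a := by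
  rw [LinearEquiv.conjAlgEquiv_apply, dualityIso_symm]
  refine (monomialBasis N M).ext fun w => ?_
  obtain ⟨v, rfl⟩ := (transposeExp M N).surjective w
  rw [monomialBasis_apply, LinearMap.comp_apply, LinearMap.comp_apply, LinearEquiv.coe_coe,
    LinearEquiv.coe_coe, dualityIso_tprod_monomial_transposeExp, partialX_tprod_monomial,
    partialX_tprod_monomial, map_smul, dualityIso_tprod_monomial,
    transposeExp_update (· - ·) (fun _ => rfl) v a i _ (fun _ => rfl)
      (transposeExp M N v a - Finsupp.single i 1) (fun _ => rfl), transposeExp_apply]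

/-! ### Duality of the operators -/

/-- The duality isomorphism carries the coefficient of the KZ operator of `gl_M` to that of the
dynamical operator of `gl_N`. -/
theorem dualityIso_conj_trigKZCoeff {M N : ℕ} {z : Fin N → ℂ} (hz : Function.Injective z)
    (lam : Fin M → ℂ) (i : Fin N) :
    (dualityIso M N).conjAlgEquiv ℂ (act (fun _ => polyRep M) (trigKZCoeff z lam i)) =
      act (fun _ => polyRep N) (trigDDCoeff lam z i) := by
  -- The Weyl relations for the operators on `ℂ[y_1, …, y_N]^{⊗M}`, with the indices exchanged.
  have hW : IsWeyl (fun (a : Fin M) (i : Fin N) => (coord i a : Module.End ℂ (PolyTensor N M)))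
      (fun a i => partialX i a) := by
    have h := isWeyl_coord_partialX N M
    exact ⟨fun a i b j => h.xx i a j b, fun a i b j => h.dd i a j b,
      fun a i b j hne => h.dx_of_ne i a j b fun h => hne (by simp_all), fun a i => h.dx i a⟩
  have h := hW.kz_eq_dd hz lam i
  simp only [trigKZCoeff, trigDDCoeff, omegaPlus, omegaMinus, map_add, map_sub, map_neg, map_sum,
    map_smul, map_mul, map_pow, coproduct_e, act_leg_e, AlgHom.commutes, AlgEquiv.commutes,
    dualityIso_conj_coord, dualityIso_conj_partialX]
  exact h

theorem dualityIso_act_trigKZCoeff {M N : ℕ} {z : Fin N → ℂ} (hz : Function.Injective z)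
    (lam : Fin M → ℂ) (i : Fin N) (v : PolyTensor M N) :
    dualityIso M N (act (fun _ => polyRep M) (trigKZCoeff z lam i) v) =
      act (fun _ => polyRep N) (trigDDCoeff lam z i) (dualityIso M N v) := by
  rw [← dualityIso_conj_trigKZCoeff hz lam i, LinearEquiv.conjAlgEquiv_apply]
  exact congrArg (fun w => dualityIso M N (act (fun _ => polyRep M) (trigKZCoeff z lam i) w))
    ((dualityIso M N).symm_apply_apply v).symm

/-- Translation of all the coordinates preserves partial derivatives. -/
theorem HasPartialDeriv.comp_sub {ι W : Type*} [DecidableEq ι] [AddCommGroup W] [Module ℂ W]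
    {f : (ι → ℂ) → W} {i : ι} {w : W} {z : ι → ℂ} (h : HasPartialDeriv f i w z) (c : ℂ) :
    HasPartialDeriv (fun x => f fun j => x j - c) i w (fun j => z j + c) := by
  intro l
  have h1 : ∀ t, (fun j => Function.update (fun j => z j + c) i t j - c)
      = Function.update z i (t - c) := by
    intro t
    ext j
    by_cases hj : j = i
    · subst hj; simp
    · simp [hj]
  simp only [h1]
  have h2 := h l
  rw [← add_sub_cancel_right (z i) c] at h2
  exact h2.comp_sub_const (z i + c) c

theorem dualityIso_rtKZ {M N : ℕ} (κ hbar η : ℂ) (lam : Fin M → ℂ) (i : Fin N)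
    {f : (Fin N → ℂ) → PolyTensor M N} {z : Fin N → ℂ} (hz : Function.Injective z)
    (hf : HasPartial f i z) :
    dualityIso M N (rtKZ (fun _ => polyRep M) κ hbar η lam i f z) =
      rtDD (fun _ => polyRep N) κ hbar η lam i (fun w => dualityIso M N (f w)) z := by
  obtain ⟨w, hw⟩ := hf
  have h1 := hw.comp_sub (η / hbar)
  have h2 := h1.map (dualityIso M N).toLinearMap
  have hz' : Function.Injective fun j => z j + η / hbar :=
    fun j k hjk => hz (add_right_cancel hjk)
  rw [rtKZ, rtDD, trigKZ, trigDD, h1.partialDeriv_eq, map_smul, map_sub, map_smul,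
    dualityIso_act_trigKZCoeff hz']
  congr 3
  exact h2.partialDeriv_eq.symm

/-- This is `dualityIso_rtKZ` for `gl_N`, read through the inverse isomorphism. -/
theorem dualityIso_rtDD {M N : ℕ} (κ hbar η : ℂ) (z : Fin N → ℂ) (a : Fin M)
    {f : (Fin M → ℂ) → PolyTensor M N} {lam : Fin M → ℂ} (hlam : Function.Injective lam)
    (hf : HasPartial f a lam) :
    dualityIso M N (rtDD (fun _ => polyRep M) κ hbar η z a f lam) =
      rtKZ (fun _ => polyRep N) κ hbar η z a (fun μ => dualityIso M N (f μ)) lam := by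
  have hf' : HasPartial (fun μ => dualityIso M N (f μ)) a lam :=
    hf.imp' (dualityIso M N) fun _ h => h.map (dualityIso M N).toLinearMap
  rw [← LinearEquiv.eq_symm_apply, dualityIso_symm, dualityIso_rtKZ κ hbar η z a hlam hf',
    ← dualityIso_symm]
  simp

end RTDuality

theorem mainTheorem3 (M N : ℕ) (κ hbar η : ℂ) (hκ : κ ≠ 0) (hhbar : hbar ≠ 0)
    (u : (Fin N → ℂ) → (Fin M → ℂ) → RTDuality.PolyTensor M N)
    (z : Fin N → ℂ) (lam : Fin M → ℂ) :
    (∀ i : Fin N, Function.Injective z →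
      RTDuality.HasPartial (fun w => u w lam) i z →
      RTDuality.dualityIso M N
          (RTDuality.rtKZ (fun _ => RTDuality.polyRep M) κ hbar η lam i (fun w => u w lam) z) =
        RTDuality.rtDD (fun _ => RTDuality.polyRep N) κ hbar η lam i
          (fun w => RTDuality.dualityIso M N (u w lam)) z) ∧
    (∀ a : Fin M, Function.Injective lam →
      RTDuality.HasPartial (fun μ => u z μ) a lam →
      RTDuality.dualityIso M N
          (RTDuality.rtDD (fun _ => RTDuality.polyRep M) κ hbar η z a (fun μ => u z μ) lam) =
        RTDuality.rtKZ (fun _ => RTDuality.polyRep N) κ hbar η z a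
          (fun μ => RTDuality.dualityIso M N (u z μ)) lam) :=
  ⟨fun i hz hu => RTDuality.dualityIso_rtKZ κ hbar η lam i hz hu,
    fun a hlam hu => RTDuality.dualityIso_rtDD κ hbar η z a hlam hu⟩
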